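/- Let $\mathbb{T} = \mathbb{R} \cup \{-\infty\} \cup \mathbb{R}^\nu$ be the extended tropical semiring, where $\mathbb{R}^\nu = \{a^\nu : a \in \mathbb{R}\}$ is a second (``ghost'') copy of the reals. Order $\mathbb{T}$ totally by: $-\infty$ is the least element; $a, a^\nu \prec b, b^\nu$ whenever $a < b$ are real; and $a \prec a^\nu$ for all $a \in \mathbb{R}$. Define $x \oplus y = \max_{\prec}\{x,y\}$ if $x \ne y$, $a \oplus a = a^\nu \oplus a^\nu = a^\nu$ for $a \in \mathbb{R}$, and $(-\infty) \oplus (-\infty) = -\infty$; define $a \odot b = a + b$, $a^\nu \odot b = a \odot b^\nu = a^\nu \odot b^\nu = (a+b)^\nu$ for $a, b \in \mathbb{R}$, and $(-\infty) \odot x = x \odot (-\infty) = -\infty$ for all $x \in \mathbb{T}$. Let $\mathbb{T}^{(n)}$ be the set of $n$-tuples of elements of $\mathbb{T}$, with entrywise addition $\oplus$ and scalar multiplication $\odot$. Vectors $v_1, \dots, v_k \in \mathbb{T}^{(n)}$ are called tropically dependent if there exist $\alpha_1, \dots, \alpha_k \in \mathbb{R} \cup \{-\infty\}$, not all equal to $-\infty$,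 such that every entry of $\alpha_1 v_1 \oplus \cdots \oplus \alpha_k v_k$ lies in $\mathbb{R}^\nu \cup \{-\infty\}$. Theorem. If $k > n$, then any $k$ vectors $v_1, \dots, v_k \in \mathbb{T}^{(n)}$ are tropically dependent. -/

import Mathlib

/-- The extended tropical semiring `𝕋`: two copies of the reals, the real elements `a` and the
ghost elements `a^ν`, glued along a common element `-∞`. -/
inductive ExtTrop : Type
  | negInf : ExtTrop
  | real : ℝ → ExtTrop
  | ghost : ℝ → ExtTrop

noncomputable section

namespace ExtTrop

/-- The order `x ≼ y` of `𝕋`: `-∞` is least, for reals `a < b` each of `a`, `a^ν` lies below each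
of `b`, `b^ν`, and `a` lies below `a^ν`. -/
protected def le : ExtTrop → ExtTrop → Prop
  | negInf, _ => True
  | real _, negInf => False
  | ghost _, negInf => False
  | real a, real b => a ≤ b
  | real a, ghost b => a ≤ b
  | ghost a, real b => a < b
  | ghost a, ghost b => a ≤ b

open Classical in
instance instLinearOrder : LinearOrder ExtTrop where
  le := ExtTrop.le
  le_refl x := by cases x <;> simp [ExtTrop.le]
  le_trans x y z := by
    cases x <;> cases y <;> cases z <;> simp only [ExtTrop.le] <;> grind
  le_antisymm x y := by
    cases x <;> cases y <;> simp only [ExtTrop.le] <;> grind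
  le_total x y := by
    cases x <;> cases y <;> simp only [ExtTrop.le] <;> grind
  toDecidableLE := Classical.decRel _

/-- The ghost map `ν`. -/
def nu : ExtTrop → ExtTrop
  | negInf => negInf
  | real a => ghost a
  | ghost a => ghost a

/-- Tropical addition `⊕`: the maximum of distinct elements, and `x ⊕ x = x^ν`
(in particular `-∞ ⊕ -∞ = -∞`). -/
protected def add (x y : ExtTrop) : ExtTrop :=
  if x = y then nu x else max x y

/-- Tropical multiplication `⊙`: addition of the underlying reals; the product is a ghost as soon
as one factor is a ghost, and `-∞` is absorbing. -/
protected def mul : ExtTrop → ExtTrop → ExtTrop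
  | negInf, _ => negInf
  | real _, negInf => negInf
  | ghost _, negInf => negInf
  | real a, real b => real (a + b)
  | real a, ghost b => ghost (a + b)
  | ghost a, real b => ghost (a + b)
  | ghost a, ghost b => ghost (a + b)

instance : Add ExtTrop := ⟨ExtTrop.add⟩
instance : Mul ExtTrop := ⟨ExtTrop.mul⟩
instance : Zero ExtTrop := ⟨negInf⟩
instance : One ExtTrop := ⟨real 0⟩

theorem zero_def : (0 : ExtTrop) = negInf := rfl
theorem one_def : (1 : ExtTrop) = real 0 := rfl

theorem negInf_add (x : ExtTrop) : negInf + x = x := by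
  change ExtTrop.add _ _ = _
  cases x <;> simp [ExtTrop.add, nu, max_def, LE.le, ExtTrop.le]

theorem add_negInf (x : ExtTrop) : x + negInf = x := by
  change ExtTrop.add _ _ = _
  cases x <;> simp [ExtTrop.add, nu, max_def, LE.le, ExtTrop.le]

theorem real_add_real (a b : ℝ) :
    real a + real b = if a = b then ghost a else if a < b then real b else real a := by
  have h : real a ≤ real b ↔ a ≤ b := Iff.rfl
  change ExtTrop.add _ _ = _
  simp only [ExtTrop.add, nu, max_def, h]
  grind

theorem real_add_ghost (a b : ℝ) :
    real a + ghost b = if a ≤ b then ghost b else real a := by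
  have h : real a ≤ ghost b ↔ a ≤ b := Iff.rfl
  change ExtTrop.add _ _ = _
  simp only [ExtTrop.add, nu, max_def, h]
  grind

theorem ghost_add_real (a b : ℝ) :
    ghost a + real b = if a < b then real b else ghost a := by
  have h : ghost a ≤ real b ↔ a < b := Iff.rfl
  change ExtTrop.add _ _ = _
  simp only [ExtTrop.add, nu, max_def, h]
  grind

theorem ghost_add_ghost (a b : ℝ) :
    ghost a + ghost b = if a ≤ b then ghost b else ghost a := by
  have h : ghost a ≤ ghost b ↔ a ≤ b := Iff.rfl
  change ExtTrop.add _ _ = _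
  simp only [ExtTrop.add, nu, max_def, h]
  grind

theorem negInf_mul (x : ExtTrop) : negInf * x = negInf := by cases x <;> rfl
theorem mul_negInf (x : ExtTrop) : x * negInf = negInf := by cases x <;> rfl
theorem real_mul_real (a b : ℝ) : real a * real b = real (a + b) := rfl
theorem real_mul_ghost (a b : ℝ) : real a * ghost b = ghost (a + b) := rfl
theorem ghost_mul_real (a b : ℝ) : ghost a * real b = ghost (a + b) := rfl
theorem ghost_mul_ghost (a b : ℝ) : ghost a * ghost b = ghost (a + b) := rfl

protected theorem add_comm (x y : ExtTrop) : x + y = y + x := by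
  cases x <;> cases y <;>
    simp only [negInf_add, add_negInf, real_add_real, real_add_ghost, ghost_add_real,
      ghost_add_ghost] <;> grind

protected theorem add_assoc (x y z : ExtTrop) : x + y + z = x + (y + z) := by
  cases x <;> cases y <;> cases z <;>
    grind [negInf_add, add_negInf, real_add_real, real_add_ghost, ghost_add_real,
      ghost_add_ghost]

protected theorem mul_comm (x y : ExtTrop) : x * y = y * x := by
  cases x <;> cases y <;>
    simp only [negInf_mul, mul_negInf, real_mul_real, real_mul_ghost, ghost_mul_real,
      ghost_mul_ghost, _root_.add_comm]

protected theorem mul_assoc (x y z : ExtTrop) : x * y * z = x * (y * z) := by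
  cases x <;> cases y <;> cases z <;>
    simp only [negInf_mul, mul_negInf, real_mul_real, real_mul_ghost, ghost_mul_real,
      ghost_mul_ghost, _root_.add_assoc]

protected theorem one_mul (x : ExtTrop) : 1 * x = x := by
  cases x <;> simp [one_def, mul_negInf, real_mul_real, real_mul_ghost]

protected theorem mul_add (x y z : ExtTrop) : x * (y + z) = x * y + x * z := by
  cases x <;> cases y <;> cases z <;>
    simp only [negInf_mul, mul_negInf, real_mul_real, real_mul_ghost, ghost_mul_real,
      ghost_mul_ghost, negInf_add, add_negInf, real_add_real, real_add_ghost, ghost_add_real,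
      ghost_add_ghost, add_right_inj, add_lt_add_iff_left, add_le_add_iff_left] <;>
    split_ifs <;>
    simp only [real_mul_real, real_mul_ghost, ghost_mul_real, ghost_mul_ghost] <;> grind

/-- `(𝕋, ⊕, ⊙)` is a commutative semiring with zero `-∞` and unit the real element `0`; hence the
space `𝕋⁽ⁿ⁾` of `n`-tuples is the `𝕋`-module `Fin n → ExtTrop`. -/
instance instCommSemiring : CommSemiring ExtTrop where
  add_assoc := ExtTrop.add_assoc
  zero_add := negInf_add
  add_zero := add_negInf
  add_comm := ExtTrop.add_comm
  nsmul := nsmulRec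
  mul_assoc := ExtTrop.mul_assoc
  one_mul := ExtTrop.one_mul
  mul_one x := by rw [ExtTrop.mul_comm, ExtTrop.one_mul]
  zero_mul := negInf_mul
  mul_zero := mul_negInf
  left_distrib := ExtTrop.mul_add
  right_distrib x y z := by
    rw [ExtTrop.mul_comm, ExtTrop.mul_add, ExtTrop.mul_comm z x, ExtTrop.mul_comm z y]
  mul_comm := ExtTrop.mul_comm

/-- The real part together with `-∞`, i.e. `ℝ ∪ {-∞}` inside `𝕋`. -/
def realBar : Set ExtTrop := insert negInf (Set.range real)

/-- The ghost part together with `-∞`. -/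
def ghostBar : Set ExtTrop := insert negInf (Set.range ghost)

/-- A vector of `𝕋⁽ⁿ⁾` is a ghost vector if each of its entries is a ghost or `-∞`. -/
def IsGhostVector {n : ℕ} (w : Fin n → ExtTrop) : Prop := ∀ j, w j ∈ ghostBar

/-- The vectors `v₁, …, vₘ` of `𝕋⁽ⁿ⁾` are tropically dependent if some combination
`α₁ v₁ ⊕ ⋯ ⊕ αₘ vₘ`, with coefficients in `ℝ ∪ {-∞}` that are not all `-∞`, is a ghost vector. -/
def TropicallyDependent {n m : ℕ} (v : Fin m → Fin n → ExtTrop) : Prop :=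
  ∃ α : Fin m → ExtTrop, (∀ i, α i ∈ realBar) ∧ (∃ i, α i ≠ negInf) ∧
    IsGhostVector (∑ i, α i • v i)

end ExtTrop

end

/-! Tropical dependence is the shadow of linear dependence over a valued field. Lift every entry to
the field of Hahn series over `ℚ` with real exponents, where the tropical value is minus the order.
More than `n` lifted vectors in dimension `n` satisfy a nontrivial linear relation; the values of
its coefficients serve as the `α i`. Lifting respects sums and products (`Lifts.add`, `Lifts.mul`),
so each entry of the tropical combination is lifted by `0`, which no real element allows
(`Lifts.mem_ghostBar`). -/

namespace ExtTrop

/-- `Lifts w t x` says that `x` is compatible with `t`: a real element `a` prescribes the value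
`-a` exactly, a ghost `a^ν` only bounds the value from below, and `-∞` forces `x = 0`. -/
def Lifts {K : Type*} [Field K] (w : AddValuation K (WithTop ℝ)) : ExtTrop → K → Prop
  | negInf, x => x = 0
  | real a, x => w x = ((-a : ℝ) : WithTop ℝ)
  | ghost a, x => ((-a : ℝ) : WithTop ℝ) ≤ w x

section Lifts

variable {K : Type*} [Field K] {w : AddValuation K (WithTop ℝ)} {s t : ExtTrop} {x y : K}

theorem coe_neg_lt_coe_neg {a b : ℝ} :
    ((-a : ℝ) : WithTop ℝ) < ((-b : ℝ) : WithTop ℝ) ↔ b < a := by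
  rw [WithTop.coe_lt_coe, neg_lt_neg_iff]

theorem coe_neg_le_coe_neg {a b : ℝ} :
    ((-a : ℝ) : WithTop ℝ) ≤ ((-b : ℝ) : WithTop ℝ) ↔ b ≤ a := by
  rw [WithTop.coe_le_coe, neg_le_neg_iff]

theorem map_add_eq_left {a : WithTop ℝ} (hx : w x = a) (hy : a < w y) : w (x + y) = a := by
  rw [← hx] at hy ⊢
  exact w.map_add_eq_of_lt_left hy

theorem Lifts.add_comm (h : Lifts w (s + t) (x + y)) : Lifts w (t + s) (y + x) := by
  rwa [_root_.add_comm t, _root_.add_comm y]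

theorem Lifts.ghost_add_ghost_of_le {a b : ℝ} (hab : a ≤ b) (hx : Lifts w (ghost a) x)
    (hy : Lifts w (ghost b) y) : Lifts w (ghost a + ghost b) (x + y) := by
  rw [ExtTrop.ghost_add_ghost, if_pos hab]
  exact w.map_le_add ((coe_neg_le_coe_neg.2 hab).trans hx) hy

theorem Lifts.real_add_ghost {a b : ℝ} (hx : Lifts w (real a) x) (hy : Lifts w (ghost b) y) :
    Lifts w (real a + ghost b) (x + y) := by
  rw [ExtTrop.real_add_ghost]
  split_ifs with hab
  · exact w.map_le_add ((coe_neg_le_coe_neg.2 hab).trans_eq hx.symm) hy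
  · exact map_add_eq_left hx ((coe_neg_lt_coe_neg.2 (not_le.1 hab)).trans_le hy)

theorem Lifts.real_add_real {a b : ℝ} (hx : Lifts w (real a) x) (hy : Lifts w (real b) y) :
    Lifts w (real a + real b) (x + y) := by
  rw [ExtTrop.real_add_real]
  split_ifs with hab hlt
  · subst hab
    -- Leading terms of equal value may cancel, so only a lower bound on the valuation survives:
    -- this is why `a ⊕ a` is a ghost.
    exact w.map_le_add hx.ge hy.ge
  · rw [_root_.add_comm x]
    exact map_add_eq_left hy ((coe_neg_lt_coe_neg.2 hlt).trans_eq hx.symm)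
  · exact map_add_eq_left hx
      ((coe_neg_lt_coe_neg.2 (lt_of_le_of_ne (not_lt.1 hlt) (Ne.symm hab))).trans_eq hy.symm)

/-- A strictly dominant real term fixes the valuation of the sum; otherwise the tropical sum is a
ghost and the ultrametric inequality suffices. -/
theorem Lifts.add (hx : Lifts w s x) (hy : Lifts w t y) : Lifts w (s + t) (x + y) := by
  cases s with
  | negInf => rwa [show x = 0 from hx, negInf_add, zero_add]
  | real a =>
    cases t with
    | negInf => rwa [show y = 0 from hy, add_negInf, add_zero]
    | real b => exact hx.real_add_real hy
    | ghost b => exact hx.real_add_ghost hy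
  | ghost a =>
    cases t with
    | negInf => rwa [show y = 0 from hy, add_negInf, add_zero]
    | real b => exact (hy.real_add_ghost hx).add_comm
    | ghost b =>
      rcases le_total a b with hab | hab
      · exact hx.ghost_add_ghost_of_le hab hy
      · exact (hy.ghost_add_ghost_of_le hab hx).add_comm

theorem coe_neg_add (a b : ℝ) :
    ((-(a + b) : ℝ) : WithTop ℝ) = ((-a : ℝ) : WithTop ℝ) + ((-b : ℝ) : WithTop ℝ) := by
  rw [neg_add, WithTop.coe_add]

theorem Lifts.mul (hx : Lifts w s x) (hy : Lifts w t y) : Lifts w (s * t) (x * y) := by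
  cases s <;> cases t <;>
    simp only [negInf_mul, mul_negInf, real_mul_real, real_mul_ghost, ghost_mul_real,
      ghost_mul_ghost, Lifts, w.map_mul, coe_neg_add] at hx hy ⊢
  case real.real => rw [hx, hy]
  case real.ghost => exact add_le_add hx.ge hy
  case ghost.real => exact add_le_add hx hy.ge
  case ghost.ghost => exact add_le_add hx hy
  all_goals simp [hx, hy]

theorem Lifts.sum {ι : Type*} (S : Finset ι) {t : ι → ExtTrop} {x : ι → K}
    (h : ∀ i ∈ S, Lifts w (t i) (x i)) : Lifts w (∑ i ∈ S, t i) (∑ i ∈ S, x i) := by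
  induction S using Finset.cons_induction with
  | empty => exact (rfl : (0 : K) = 0)
  | cons i S hi ih =>
    rw [Finset.sum_cons, Finset.sum_cons]
    exact (h i (Finset.mem_cons_self i S)).add
      (ih fun j hj => h j (Finset.mem_cons_of_mem hj))

/-- The valuation of `0` is `⊤`, which exceeds every real bound but equals no real number. -/
theorem Lifts.mem_ghostBar (h : Lifts w t 0) : t ∈ ghostBar := by
  cases t with
  | negInf => exact Or.inl rfl
  | real a => exact absurd (w.map_zero.symm.trans h) WithTop.top_ne_coe
  | ghost a => exact Or.inr ⟨a, rfl⟩

end Lifts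

/-- Every element of `𝕋` lifts to a Hahn series with real exponents. -/
theorem exists_lifts (t : ExtTrop) :
    ∃ x : HahnSeries ℝ ℚ, Lifts (HahnSeries.addVal ℝ ℚ) t x := by
  have key (a : ℝ) : HahnSeries.addVal ℝ ℚ (HahnSeries.single (-a) 1) = ((-a : ℝ) : WithTop ℝ) := by
    rw [HahnSeries.addVal_apply, HahnSeries.orderTop_single one_ne_zero]
  cases t with
  | negInf => exact ⟨0, rfl⟩
  | real a => exact ⟨_, key a⟩
  -- A ghost only asks for a lower bound, so the monomial used for `real a` serves again.
  | ghost a => exact ⟨_, (key a).ge⟩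

/-- Every element of a valued field lifts an element of `ℝ ∪ {-∞}`. -/
theorem exists_realBar_lifts {K : Type*} [Field K] (w : AddValuation K (WithTop ℝ)) (x : K) :
    ∃ t ∈ realBar, Lifts w t x ∧ (x ≠ 0 → t ≠ negInf) := by
  by_cases hx : x = 0
  · exact ⟨negInf, Or.inl rfl, hx, fun h => absurd hx h⟩
  · obtain ⟨a, ha⟩ := WithTop.ne_top_iff_exists.1 (mt (AddValuation.top_iff w).1 hx)
    refine ⟨real (-a), Or.inr ⟨-a, rfl⟩, ?_, fun _ => nofun⟩
    rw [Lifts, neg_neg, ha]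

end ExtTrop

theorem mainTheorem8 (n k : ℕ) (hk : n < k) (v : Fin k → Fin n → ExtTrop) :
    ExtTrop.TropicallyDependent v := by
  choose f hf using fun i j => ExtTrop.exists_lifts (v i j)
  have hdep : ¬ LinearIndependent (HahnSeries ℝ ℚ) f := fun h => by
    have := h.fintype_card_le_finrank
    simp only [Fintype.card_fin, Module.finrank_fin_fun] at this
    omega
  obtain ⟨c, hc, i₀, hi₀⟩ := Fintype.not_linearIndependent_iff.1 hdep
  choose α hα hlift hne using
    fun i => ExtTrop.exists_realBar_lifts (HahnSeries.addVal ℝ ℚ) (c i)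
  -- A nonzero coefficient of the linear relation has finite valuation, so its tropical value is not
  -- `-∞`.
  refine ⟨α, hα, ⟨i₀, hne i₀ hi₀⟩, fun j => ?_⟩
  have hsum := ExtTrop.Lifts.sum Finset.univ fun i _ => (hlift i).mul (hf i j)
  have hzero : ∑ i, c i * f i j = 0 := by
    simpa [Finset.sum_apply] using congrFun hc j
  rw [hzero] at hsum
  simpa [Finset.sum_apply] using hsum.mem_ghostBar
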